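/- Let $F\subset\mathbb R^2$ be a nonempty finite set, let $D\subset\mathbb R^2$ be a compact convex polygon with nonempty interior, and let $\alpha>0$. Let $\mathcal M(F)$ be the space of signed Borel measures on $F$, identified with $\mathbb R^{F}$ via $v\mapsto\sum_{x\in F}v_x\delta_x$, and let $g\colon\mathcal M(F)\to\mathbb R$ be twice continuously differentiable. Let $u_d$ be a nonnegative finite Borel measure on $D$ which is absolutely continuous with respect to the Lebesgue measure with a density that is continuous on $D$. For $u\in\mathcal M(F)$ let $$W_2^2(u_d,u):=\inf_{\gamma}\int_{D\times F}|x_1-x_2|^2\,\mathrm d\gamma(x_1,x_2)\in[0,\infty],$$ where the infimum is over all nonnegative finite Borel measures $\gamma$ on $D\times F$ with first marginal $u_d$ and second marginal $u$ (and $\inf\emptyset=\infty$). Consider the problem $$\text{(P)}\qquad\text{minimize}\quad g(u)+\frac\alpha2W_2^2(u_d,u)\quad\text{over } u\in\mathcal M(F).$$ Then (P) has a global solution, and the minimal value is finite. If $g$ is convex, the global solution of (P) is unique. Moreover, $W_2^2(u_d,\cdot)$ is strictly convex on the convex set $\{u\in\mathcal M(F): W_2^2(u_d,u)<\infty\}$.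 -/

import Mathlib

open MeasureTheory
open scoped ENNReal NNReal

noncomputable section

namespace OTReg

/-- The Euclidean plane. -/
abbrev Plane : Type := EuclideanSpace ℝ (Fin 2)

/-- The signed measure `∑ x ∈ F, v x • δ_x` on the finite set `F`, i.e. the identification of
coefficient vectors with signed Borel measures on `F`. -/
def ofCoeff (F : Finset Plane) (v : F → ℝ) : SignedMeasure F :=
  ∑ x : F, v x • (Measure.dirac x).toSignedMeasure

/-- `g`, a functional on signed measures on the finite set `F`, is twice continuously
differentiable, expressed in the coordinates given by the Dirac measures. -/
def IsC2 (F : Finset Plane) (g : SignedMeasure F → ℝ) : Prop :=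
  ContDiff ℝ 2 fun v : F → ℝ => g (ofCoeff F v)

/-- Couplings of a nonnegative finite measure `μ` on `D` with a signed measure `u` on `F`:
nonnegative finite measures on `D × F` with marginals `μ` and `u`. -/
def couplings {D : Set Plane} {F : Finset Plane} (μ : FiniteMeasure D) (u : SignedMeasure F) :
    Set (FiniteMeasure (D × F)) :=
  {γ | γ.map Prod.fst = μ ∧ (γ.map Prod.snd : Measure F).toSignedMeasure = u}

/-- The squared quadratic Monge-Kantorovich distance, with values in `[0, ∞]`; it is `∞` if there
is no coupling. -/
def W2sq {D : Set Plane} {F : Finset Plane} (μ : FiniteMeasure D) (u : SignedMeasure F) : ℝ≥0∞ :=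
  ⨅ γ ∈ couplings μ u, ∫⁻ p : D × F, ‖(p.1 : Plane) - (p.2 : Plane)‖ₑ ^ 2 ∂(γ : Measure (D × F))

/-- The objective `g(u) + (α / 2) W₂²(μ, u)`, with values in the extended reals. -/
def objective {D : Set Plane} {F : Finset Plane} (g : SignedMeasure F → ℝ) (α : ℝ)
    (μ : FiniteMeasure D) (u : SignedMeasure F) : EReal :=
  (g u : EReal) + ((α / 2 : ℝ) : EReal) * (W2sq μ u : EReal)

/-- `u` minimizes the objective over all signed measures on `F`. -/
def IsGlobalSolution {D : Set Plane} {F : Finset Plane} (g : SignedMeasure F → ℝ) (α : ℝ)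
    (μ : FiniteMeasure D) (u : SignedMeasure F) : Prop :=
  ∀ v : SignedMeasure F, objective g α μ u ≤ objective g α μ v

end OTReg

end

/-! For existence, minimize over plans `γ` with first marginal `μ` instead of over `u`. These form a
weakly compact set, on which `g` of the second marginal plus `α / 2` times the cost is continuous,
so no growth of `g` is needed. The second marginal of a minimizer solves (P).

Strict convexity rests on `mutuallySingular_slice_of_optimal`: under an optimal plan, the masses
sent to two distinct points `x`, `y` are mutually singular. Otherwise they share a nonzero part `ν`.
The level sets of `|p - x|² - |p - y|²` are null (lines at most), so this difference is not constant
`ν`-a.e. and swapping targets within `ν` lowers the cost. Let `γ`, `γ'` be optimal for `u`, `v`. If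
convexity held with equality, `a • γ + b • γ'` would be optimal, so the slice of `γ` over `x` would
be singular to that of `γ'` over `y` whenever `x ≠ y`. As the first marginals agree, all slices then
agree and `u = v`. Uniqueness for convex `g` follows. -/

namespace OTReg

/-! ### Exchange of mass and singular measures -/

/-- If no level set of `a - b` charges the nonzero finite measure `ν`, then two submeasures of `ν`
of equal mass can be exchanged at a strict gain. -/
theorem exists_strict_exchange {X : Type*} [MeasurableSpace X] (ν : Measure X) [IsFiniteMeasure ν]
    (hν : ν ≠ 0) {a b : X → ℝ} (ham : Measurable a) (hbm : Measurable b)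
    (ha : Integrable a ν) (hb : Integrable b ν) (hlev : ∀ c, ν {p | a p - b p = c} = 0) :
    ∃ ν₁ ν₂ : Measure X, ν₁ ≤ ν ∧ ν₂ ≤ ν ∧ ν₁ Set.univ = ν₂ Set.univ ∧
      ∫ p, a p ∂ν₁ + ∫ p, b p ∂ν₂ < ∫ p, a p ∂ν₂ + ∫ p, b p ∂ν₁ := by
  -- At the mean value `c`, both `{a - b < c}` and `{a - b > c}` have positive mass, since the level
  -- `c` is null.
  set c := ⨍ p, (a p - b p) ∂ν
  have hab : Integrable (fun p => a p - b p) ν := ha.sub hb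
  have habm : Measurable fun p => a p - b p := ham.sub hbm
  set A := {p | a p - b p < c}
  set B := {p | c < a p - b p}
  have hAm : MeasurableSet A := measurableSet_lt habm measurable_const
  have hBm : MeasurableSet B := measurableSet_lt measurable_const habm
  have hApos : ν A ≠ 0 := by
    intro h
    refine (measure_le_average_pos hν hab).ne' (measure_mono_null ?_ (measure_union_null h (hlev c)))
    intro p hp
    rcases lt_or_eq_of_le (show a p - b p ≤ c from hp) with h | h
    exacts [Or.inl h, Or.inr h]
  have hBpos : ν B ≠ 0 := by
    intro h
    refine (measure_average_le_pos hν hab).ne' (measure_mono_null ?_ (measure_union_null h (hlev c)))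
    intro p hp
    rcases lt_or_eq_of_le (show c ≤ a p - b p from hp) with h | h
    exacts [Or.inl h, Or.inr h.symm]
  have htt : ν Set.univ ≠ ∞ := measure_ne_top _ _
  have hle : ∀ S T : Set X, (ν S / ν Set.univ) • ν.restrict T ≤ ν := fun S T => by
    refine Measure.le_iff.2 fun s _ => ?_
    rw [Measure.smul_apply, smul_eq_mul]
    calc _ ≤ 1 * ν s := by
          gcongr
          · exact ENNReal.div_le_of_le_mul (by simpa using measure_mono (Set.subset_univ S))
          · exact Measure.restrict_le_self
      _ = ν s := one_mul _
  have h1 := hle B A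
  have h2 := hle A B
  -- Cross-weighting gives both measures the mass `ν A * ν B / ν univ`, with factors at most 1.
  set ν₁ := (ν B / ν Set.univ) • ν.restrict A with hν₁
  set ν₂ := (ν A / ν Set.univ) • ν.restrict B with hν₂
  have hfin : IsFiniteMeasure ν₁ := isFiniteMeasure_of_le ν h1
  have hfin' : IsFiniteMeasure ν₂ := isFiniteMeasure_of_le ν h2
  have hmass : ν₁ Set.univ = ν₂ Set.univ := by
    simp only [hν₁, hν₂, Measure.smul_apply, Measure.restrict_apply_univ, smul_eq_mul]
    rw [ENNReal.div_eq_inv_mul, ENNReal.div_eq_inv_mul, mul_assoc, mul_assoc, mul_comm (ν A)]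
  refine ⟨ν₁, ν₂, h1, h2, hmass, ?_⟩
  have ha1 := ha.mono_measure h1
  have ha2 := ha.mono_measure h2
  have hb1 := hb.mono_measure h1
  have hb2 := hb.mono_measure h2
  have hpos : 0 < ∫ p, (c - (a p - b p)) ∂ν₁ := by
    rw [integral_pos_iff_support_of_nonneg_ae]
    · refine lt_of_lt_of_le (pos_iff_ne_zero.2 ?_) (measure_mono (s := A) ?_)
      · simp only [hν₁, Measure.smul_apply, smul_eq_mul, Measure.restrict_apply_self]
        exact mul_ne_zero (ENNReal.div_ne_zero.2 ⟨hBpos, htt⟩) hApos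
      · intro p hp
        exact (sub_pos.2 (show a p - b p < c from hp)).ne'
    · refine Measure.ae_smul_measure ?_ _
      filter_upwards [ae_restrict_mem hAm] with p hp
      exact (sub_pos.2 (show a p - b p < c from hp)).le
    · exact (integrable_const c).sub (ha1.sub hb1)
  have hnn : 0 ≤ ∫ p, ((a p - b p) - c) ∂ν₂ := by
    refine integral_nonneg_of_ae (Measure.ae_smul_measure ?_ _)
    filter_upwards [ae_restrict_mem hBm] with p hp
    exact (sub_pos.2 (show c < a p - b p from hp)).le
  rw [integral_sub (integrable_const c) (hab.mono_measure h1), integral_sub ha1 hb1, integral_const] at hpos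
  rw [integral_sub (hab.mono_measure h2) (integrable_const c), integral_sub ha2 hb2, integral_const] at hnn
  simp only [measureReal_def, hmass] at hpos hnn
  linarith

/-- Off a `κ`-null set carrying `R`, the term `R` contributes nothing. -/
theorem le_of_le_add_of_mutuallySingular {X : Type*} [MeasurableSpace X] {κ β R : Measure X}
    (h : κ ≤ β + R) (hs : κ ⟂ₘ R) : κ ≤ β := by
  refine Measure.le_iff.2 fun s _ => ?_
  obtain ⟨N, -, hκ, hR⟩ := hs
  calc κ s ≤ κ (s ∩ N) + κ (s \ N) := measure_le_inter_add_sdiff _ _ _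
    _ = κ (s \ N) := by rw [measure_mono_null Set.inter_subset_right hκ, zero_add]
    _ ≤ β (s \ N) + R (s \ N) := h _
    _ = β (s \ N) := by
        rw [measure_mono_null (fun p hp => hp.2 : s \ N ⊆ Nᶜ) hR, add_zero]
    _ ≤ β s := measure_mono Set.sdiff_subset

/-! ### Decomposition of a plan into slices -/

section Slice

variable {X Y : Type*} [MeasurableSpace X] [MeasurableSpace Y]

/-- The part of a measure on `X × Y` sitting over `y`, as a measure on `X`. -/
noncomputable def slice (γ : Measure (X × Y)) (y : Y) : Measure X :=
  (γ.restrict (Prod.snd ⁻¹' {y})).map Prod.fst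

theorem slice_add (γ γ' : Measure (X × Y)) (y : Y) :
    slice (γ + γ') y = slice γ y + slice γ' y := by
  rw [slice, Measure.restrict_add, Measure.map_add _ _ measurable_fst, slice, slice]

theorem slice_smul (c : ℝ≥0) (γ : Measure (X × Y)) (y : Y) :
    slice (c • γ) y = c • slice γ y := by
  rw [slice, Measure.restrict_smul, Measure.map_smul, slice]

theorem slice_univ (γ : Measure (X × Y)) (y : Y) :
    slice γ y Set.univ = γ (Prod.snd ⁻¹' {y}) := by
  rw [slice, Measure.map_apply measurable_fst MeasurableSet.univ]
  simp

theorem slice_le (γ : Measure (X × Y)) (y : Y) : slice γ y ≤ γ.map Prod.fst :=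
  Measure.map_mono Measure.restrict_le_self measurable_fst

theorem map_slice [MeasurableSingletonClass Y] (γ : Measure (X × Y)) (y : Y) :
    (slice γ y).map (fun p => (p, y)) = γ.restrict (Prod.snd ⁻¹' {y}) := by
  rw [slice, Measure.map_map (by fun_prop) (by fun_prop)]
  conv_rhs => rw [← Measure.map_id (μ := γ.restrict (Prod.snd ⁻¹' {y}))]
  refine Measure.map_congr ?_
  filter_upwards [ae_restrict_mem (measurable_snd (measurableSet_singleton y))] with p hp
  exact Prod.ext rfl hp.symm

theorem map_slice_add_le [MeasurableSingletonClass Y] (γ : Measure (X × Y)) {x y : Y}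
    (hxy : x ≠ y) :
    (slice γ x).map (fun p => (p, x)) + (slice γ y).map (fun p => (p, y)) ≤ γ := by
  rw [map_slice, map_slice, ← Measure.restrict_union
    (Disjoint.preimage _ (Set.disjoint_singleton.2 hxy))
    (measurable_snd (measurableSet_singleton y))]
  exact Measure.restrict_le_self

theorem sum_slice [Fintype Y] [MeasurableSingletonClass Y] (γ : Measure (X × Y)) :
    ∑ y, slice γ y = γ.map Prod.fst := by
  ext s hs
  rw [Measure.finsetSum_apply, Measure.map_apply measurable_fst hs]
  have : ∀ y, slice γ y s = γ (Prod.fst ⁻¹' s ∩ Prod.snd ⁻¹' {y}) := fun y => by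
    rw [slice, Measure.map_apply measurable_fst hs, Measure.restrict_apply (measurable_fst hs)]
  simp only [this]
  rw [← measure_biUnion_finset]
  · congr 1
    ext p
    simp
  · intro y _ z _ hyz
    exact ((Set.disjoint_singleton.2 hyz).preimage Prod.snd).mono Set.inter_subset_right
      Set.inter_subset_right
  · exact fun y _ => (measurable_fst hs).inter (measurable_snd (measurableSet_singleton y))

/-- If two measures have the same first marginal and their slices over distinct points are mutually
singular, then each slice of the first is dominated by that of the second. -/
theorem slice_le_slice_of_mutuallySingular [Fintype Y] [MeasurableSingletonClass Y]
    {γ γ' : Measure (X × Y)} (hfst : γ.map Prod.fst = γ'.map Prod.fst)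
    (hs : ∀ x y, x ≠ y → slice γ x ⟂ₘ slice γ' y) (x : Y) : slice γ x ≤ slice γ' x := by
  classical
  refine le_of_le_add_of_mutuallySingular (R := Measure.sum fun y : {y // y ≠ x} => slice γ' y) ?_
    (Measure.MutuallySingular.sum_right.2 fun y => hs x y y.2.symm)
  rw [Measure.sum_fintype]
  have : slice γ' x + ∑ y : {y // y ≠ x}, slice γ' y = γ'.map Prod.fst := by
    rw [← sum_slice, ← Finset.add_sum_erase _ _ (Finset.mem_univ x)]
    congr 1
    exact (Finset.sum_subtype _ (by simp) _).symm
  rw [this, ← hfst]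
  exact slice_le γ x

end Slice

/-! ### Null level sets -/

theorem volume_inner_eq_zero {v : Plane} (hv : v ≠ 0) (c : ℝ) :
    volume {p : Plane | inner ℝ v p = c} = 0 := by
  rcases Set.eq_empty_or_nonempty {p : Plane | inner ℝ v p = c} with h | ⟨q, hq⟩
  · simp [h]
  have hq : inner ℝ v q = c := hq
  have hS : {p : Plane | inner ℝ v p = c} = (AffineSubspace.mk' q (ℝ ∙ v)ᗮ : Set Plane) := by
    ext p
    simp [AffineSubspace.mem_mk', Submodule.mem_orthogonal_singleton_iff_inner_right,
      inner_sub_right, sub_eq_zero, hq]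
  rw [hS]
  refine Measure.addHaar_affineSubspace _ _ fun htop => hv ?_
  have := congrArg AffineSubspace.direction htop
  rw [AffineSubspace.direction_mk', AffineSubspace.direction_top] at this
  have hmem : v ∈ (ℝ ∙ v)ᗮ := this ▸ Submodule.mem_top
  rw [Submodule.mem_orthogonal_singleton_iff_inner_right] at hmem
  exact inner_self_eq_zero.1 hmem

/-- An absolutely continuous measure does not charge the level sets of the difference of the
squared distances to two distinct points. -/
theorem measure_level_eq_zero {D : Set Plane} (hDm : MeasurableSet D) {μ : Measure D}
    (hμ : μ ≪ (volume : Measure Plane).comap Subtype.val) {x y : Plane} (hxy : x ≠ y) (c : ℝ) :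
    μ {p : D | ‖(p : Plane) - x‖ ^ 2 - ‖(p : Plane) - y‖ ^ 2 = c} = 0 := by
  apply hμ
  have hemb : MeasurableEmbedding (Subtype.val : D → Plane) := MeasurableEmbedding.subtype_coe hDm
  rw [hemb.comap_apply]
  refine measure_mono_null ?_ (volume_inner_eq_zero (sub_ne_zero.2 hxy.symm)
    ((c - ‖x‖ ^ 2 + ‖y‖ ^ 2) / 2))
  rintro _ ⟨p, hp, rfl⟩
  have hp : ‖(p : Plane) - x‖ ^ 2 - ‖(p : Plane) - y‖ ^ 2 = c := hp
  rw [@norm_sub_sq_real, @norm_sub_sq_real] at hp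
  change inner ℝ (y - x) (p : Plane) = _
  rw [inner_sub_left, real_inner_comm, real_inner_comm _ x]
  linarith

/-! ### Transport cost and the exchange argument for optimal plans -/

variable {D : Set Plane} {F : Finset Plane}

/-- The quadratic transport cost of a plan. -/
noncomputable def transportCost (γ : Measure (D × F)) : ℝ≥0∞ :=
  ∫⁻ p : D × F, ‖(p.1 : Plane) - (p.2 : Plane)‖ₑ ^ 2 ∂γ

theorem transportCost_add (γ γ' : Measure (D × F)) :
    transportCost (γ + γ') = transportCost γ + transportCost γ' :=
  lintegral_add_measure _ _ _

theorem transportCost_smul (c : ℝ≥0) (γ : Measure (D × F)) :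
    transportCost (c • γ) = c * transportCost γ := by
  simp only [transportCost, lintegral_smul_measure]
  rfl

/-- The quadratic cost as a continuous function. -/
noncomputable def quadraticCost (D : Set Plane) (F : Finset Plane) : C(D × F, ℝ≥0) where
  toFun p := ‖(p.1 : Plane) - (p.2 : Plane)‖₊ ^ 2
  continuous_toFun := by fun_prop

theorem transportCost_eq (γ : Measure (D × F)) :
    transportCost γ = ∫⁻ p, quadraticCost D F p ∂γ := by
  simp [transportCost, quadraticCost, enorm]

theorem transportCost_lt_top [CompactSpace D] (γ : Measure (D × F)) [IsFiniteMeasure γ] :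
    transportCost γ < ∞ := by
  rw [transportCost_eq]
  exact BoundedContinuousFunction.lintegral_lt_top_of_nnreal γ
    (BoundedContinuousFunction.mkOfCompact (quadraticCost D F))

theorem continuous_transportCost [CompactSpace D] :
    Continuous fun γ : FiniteMeasure (D × F) => transportCost (γ : Measure (D × F)) := by
  simp only [transportCost_eq]
  exact FiniteMeasure.continuous_lintegral_continuousMap (quadraticCost D F)

theorem transportCost_map_prodMk [CompactSpace D] (ν : Measure D) [IsFiniteMeasure ν] (x : F) :
    transportCost (ν.map fun p => (p, x)) =
      ENNReal.ofReal (∫ p : D, ‖(p : Plane) - (x : Plane)‖ ^ 2 ∂ν) := by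
  rw [ofReal_integral_eq_lintegral_ofReal, transportCost, lintegral_map (by fun_prop) (by fun_prop)]
  · simp [ENNReal.ofReal_pow, ofReal_norm]
  · exact Continuous.integrable_of_hasCompactSupport (by fun_prop)
      (HasCompactSupport.of_compactSpace _)
  · exact Filter.Eventually.of_forall fun p => by positivity

theorem measure_eq_of_add_eq_add {X : Type*} [MeasurableSpace X] {a b c : Measure X}
    [IsFiniteMeasure c] (h : a + c = b + c) : a = b := by
  ext s hs
  have := congrArg (fun m : Measure X => m s) h
  simpa [measure_ne_top] using this

theorem map_fst_map_prodMk {X Y : Type*} [MeasurableSpace X] [MeasurableSpace Y] (ν : Measure X)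
    (y : Y) : (ν.map fun p => (p, y)).map Prod.fst = ν := by
  rw [Measure.map_map (by fun_prop) (by fun_prop)]
  exact Measure.map_id

theorem map_snd_map_prodMk {X Y : Type*} [MeasurableSpace X] [MeasurableSpace Y] (ν : Measure X)
    (y : Y) : (ν.map fun p => (p, y)).map Prod.snd = ν Set.univ • Measure.dirac y := by
  rw [Measure.map_map (by fun_prop) (by fun_prop)]
  exact Measure.map_const ν y

/-- The slices of an optimal plan are mutually singular if the first marginal is absolutely
continuous: otherwise, mass could be exchanged at a strict gain. -/
theorem mutuallySingular_slice_of_optimal [CompactSpace D] {μ : FiniteMeasure D}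
    (hμ : (μ : Measure D) ≪ (volume : Measure Plane).comap Subtype.val) {u : SignedMeasure F}
    {γ : FiniteMeasure (D × F)} (hγ : γ ∈ couplings μ u)
    (hopt : ∀ γ' ∈ couplings μ u, transportCost (γ : Measure (D × F)) ≤
      transportCost (γ' : Measure (D × F)))
    {x y : F} (hxy : x ≠ y) :
    slice (γ : Measure (D × F)) x ⟂ₘ slice (γ : Measure (D × F)) y := by
  have hDm : MeasurableSet D := (isCompact_iff_compactSpace.2 ‹_›).isClosed.measurableSet
  by_contra hsing
  set g : Measure (D × F) := (γ : Measure (D × F))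
  have hfst : g.map Prod.fst = μ := congrArg FiniteMeasure.toMeasure hγ.1
  -- The common part of the two slices; it is nonzero exactly when they are not mutually singular.
  set ν : Measure D := slice g x ⊓ slice g y
  have hν0 : ν ≠ 0 := fun h => hsing
    (Measure.mutuallySingular_iff_disjoint.2 (disjoint_iff.2 h))
  have hνμ : ν ≤ μ := (inf_le_left.trans (slice_le g x)).trans hfst.le
  have : IsFiniteMeasure ν := isFiniteMeasure_of_le _ hνμ
  have hint : ∀ z : F, Integrable (fun p : D => ‖(p : Plane) - (z : Plane)‖ ^ 2) ν := fun z =>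
    Continuous.integrable_of_hasCompactSupport (by fun_prop) (HasCompactSupport.of_compactSpace _)
  obtain ⟨ν₁, ν₂, h1, h2, hmass, hlt⟩ := exists_strict_exchange ν hν0
    (a := fun p : D => ‖(p : Plane) - (x : Plane)‖ ^ 2)
    (b := fun p : D => ‖(p : Plane) - (y : Plane)‖ ^ 2) (by fun_prop) (by fun_prop)
    (hint x) (hint y) fun c => measure_level_eq_zero hDm (hνμ.absolutelyContinuous.trans hμ)
      (Subtype.coe_injective.ne hxy) c
  have : IsFiniteMeasure ν₁ := isFiniteMeasure_of_le _ h1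
  have : IsFiniteMeasure ν₂ := isFiniteMeasure_of_le _ h2
  -- `σ` is removed from the plan and `τ` inserted: `ν₁` moves from `y` to `x`, `ν₂` from `x` to
  -- `y`. Equal masses preserve the second marginal.
  set σ : Measure (D × F) := ν₂.map (fun p => (p, x)) + ν₁.map (fun p => (p, y)) with hσ
  set τ : Measure (D × F) := ν₁.map (fun p => (p, x)) + ν₂.map (fun p => (p, y)) with hτ
  have hσg : σ ≤ g := by
    refine le_trans (add_le_add ?_ ?_) (map_slice_add_le g hxy)
    · exact Measure.map_mono (h2.trans inf_le_left) (by fun_prop)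
    · exact Measure.map_mono (h1.trans inf_le_right) (by fun_prop)
  -- Subtraction of measures is truncated, so marginals and costs are compared after adding `σ` back
  -- and cancelling finite terms.
  have hsum : g - σ + τ + σ = g + τ := by
    rw [add_right_comm, Measure.sub_add_cancel_of_le hσg]
  have : IsFiniteMeasure (g - σ) := isFiniteMeasure_of_le g Measure.sub_le
  have hmapfst : (g - σ + τ).map Prod.fst = g.map Prod.fst := by
    have h := congrArg (Measure.map Prod.fst) hsum
    rw [Measure.map_add _ σ measurable_fst, Measure.map_add g τ measurable_fst] at h
    have hστ : σ.map Prod.fst = τ.map Prod.fst := by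
      simp only [hσ, hτ, Measure.map_add _ _ measurable_fst, map_fst_map_prodMk, add_comm]
    rw [hστ] at h
    exact measure_eq_of_add_eq_add h
  have hmapsnd : (g - σ + τ).map Prod.snd = g.map Prod.snd := by
    have h := congrArg (Measure.map Prod.snd) hsum
    rw [Measure.map_add _ σ measurable_snd, Measure.map_add g τ measurable_snd] at h
    have hστ : σ.map Prod.snd = τ.map Prod.snd := by
      simp only [hσ, hτ, Measure.map_add _ _ measurable_snd, map_snd_map_prodMk, hmass]
    rw [hστ] at h
    exact measure_eq_of_add_eq_add h
  let γ' : FiniteMeasure (D × F) := ⟨g - σ + τ, inferInstance⟩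
  have hγ' : γ' ∈ couplings μ u := by
    constructor
    · apply FiniteMeasure.toMeasure_injective
      exact hmapfst.trans hfst
    · rw [← hγ.2]
      exact Measure.toSignedMeasure_congr hmapsnd
  have hcost : transportCost τ < transportCost σ := by
    simp only [hσ, hτ, transportCost_add, transportCost_map_prodMk]
    rw [← ENNReal.ofReal_add (integral_nonneg fun _ => by positivity)
      (integral_nonneg fun _ => by positivity), ← ENNReal.ofReal_add
      (integral_nonneg fun _ => by positivity) (integral_nonneg fun _ => by positivity)]
    exact (ENNReal.ofReal_lt_ofReal_iff_of_nonneg (add_nonneg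
      (integral_nonneg fun _ => by positivity) (integral_nonneg fun _ => by positivity))).2 hlt
  have hle : transportCost g ≤ transportCost (g - σ + τ) := hopt γ' hγ'
  have hc := congrArg transportCost hsum
  rw [transportCost_add _ σ, transportCost_add g τ] at hc
  refine hc.not_gt ?_
  calc transportCost g + transportCost τ < transportCost g + transportCost σ :=
        ENNReal.add_lt_add_left (transportCost_lt_top g).ne hcost
    _ ≤ _ := by gcongr

/-! ### Weak compactness and attainment -/

theorem isClosed_couplings (μ : FiniteMeasure D) (u : SignedMeasure F) :
    IsClosed (couplings μ u) := by
  have h1 : IsClosed {γ : FiniteMeasure (D × F) | γ.map Prod.fst = μ} :=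
    isClosed_singleton.preimage (FiniteMeasure.continuous_map continuous_fst)
  have h2 : IsClosed {ν : FiniteMeasure F | (ν : Measure F).toSignedMeasure = u} := by
    -- A signed measure comes from at most one nonnegative measure, so the constraint is the
    -- preimage of at most one point.
    refine Set.Subsingleton.isClosed fun ν hν ν' hν' => ?_
    exact FiniteMeasure.toMeasure_injective
      (Measure.toSignedMeasure_eq_toSignedMeasure_iff.1 (hν.trans hν'.symm))
  exact h1.inter (h2.preimage (FiniteMeasure.continuous_map continuous_snd))

/-- Such plans all have the mass of `μ`, and bounded mass on a compact space gives weak compactness.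
-/
theorem isCompact_setOf_map_fst_eq [CompactSpace D] (μ : FiniteMeasure D) :
    IsCompact {γ : FiniteMeasure (D × F) | γ.map Prod.fst = μ} := by
  refine (isCompact_setOfPred_finiteMeasure_le_of_compactSpace (D × F) μ.mass).of_isClosed_subset
    (isClosed_singleton.preimage (FiniteMeasure.continuous_map continuous_fst)) ?_
  rintro γ rfl
  change γ.mass ≤ (γ.map Prod.fst).mass
  refine le_of_eq ?_
  rw [← ENNReal.coe_inj, FiniteMeasure.ennreal_mass, FiniteMeasure.ennreal_mass,
    FiniteMeasure.toMeasure_map, Measure.map_apply measurable_fst MeasurableSet.univ,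
    Set.preimage_univ]

theorem W2sq_le {μ : FiniteMeasure D} {u : SignedMeasure F} {γ : FiniteMeasure (D × F)}
    (hγ : γ ∈ couplings μ u) : W2sq μ u ≤ transportCost (γ : Measure (D × F)) :=
  iInf₂_le γ hγ

/-- The infimum defining `W2sq` is attained if it is finite. -/
theorem exists_optimal [CompactSpace D] {μ : FiniteMeasure D} {u : SignedMeasure F}
    (h : W2sq μ u < ∞) :
    ∃ γ ∈ couplings μ u, transportCost (γ : Measure (D × F)) = W2sq μ u := by
  have hne : (couplings μ u).Nonempty := by
    by_contra hne
    rw [Set.not_nonempty_iff_eq_empty] at hne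
    simp [W2sq, hne] at h
  obtain ⟨γ, hγ, hmin⟩ := ((isCompact_setOf_map_fst_eq μ).of_isClosed_subset
    (isClosed_couplings μ u) fun γ hγ => hγ.1).exists_isMinOn hne
    continuous_transportCost.continuousOn
  exact ⟨γ, hγ, le_antisymm (le_iInf₂ fun γ' hγ' => hmin hγ') (W2sq_le hγ)⟩

theorem W2sq_lt_top_of_mem [CompactSpace D] {μ : FiniteMeasure D} {u : SignedMeasure F}
    {γ : FiniteMeasure (D × F)} (hγ : γ ∈ couplings μ u) : W2sq μ u < ∞ :=
  (W2sq_le hγ).trans_lt (transportCost_lt_top _)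

/-! ### Strict convexity -/

theorem add_smul_mem_couplings {μ : FiniteMeasure D} {u v : SignedMeasure F}
    {γ γ' : FiniteMeasure (D × F)} (hγ : γ ∈ couplings μ u) (hγ' : γ' ∈ couplings μ v)
    {a b : ℝ≥0} (hab : a + b = 1) :
    a • γ + b • γ' ∈ couplings μ ((a : ℝ) • u + (b : ℝ) • v) := by
  constructor
  · rw [FiniteMeasure.map_add measurable_fst, FiniteMeasure.map_smul, FiniteMeasure.map_smul,
      hγ.1, hγ'.1, ← add_smul, hab, one_smul]
  · rw [← hγ.2, ← hγ'.2]
    have h : (((a • γ + b • γ').map Prod.snd : FiniteMeasure F) : Measure F) =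
        a • ((γ.map Prod.snd : FiniteMeasure F) : Measure F) +
          b • ((γ'.map Prod.snd : FiniteMeasure F) : Measure F) := by
      rw [FiniteMeasure.map_add measurable_snd, FiniteMeasure.map_smul, FiniteMeasure.map_smul]
      rfl
    rw [Measure.toSignedMeasure_congr h, Measure.toSignedMeasure_add,
      Measure.toSignedMeasure_smul, Measure.toSignedMeasure_smul]
    rfl

/-- Couplings whose slices over every point agree have the same second marginal. -/
theorem eq_of_slice_eq {μ : FiniteMeasure D} {u v : SignedMeasure F}
    {γ γ' : FiniteMeasure (D × F)} (hγ : γ ∈ couplings μ u) (hγ' : γ' ∈ couplings μ v)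
    (h : ∀ x : F, slice (γ : Measure (D × F)) x = slice (γ' : Measure (D × F)) x) : u = v := by
  rw [← hγ.2, ← hγ'.2]
  refine Measure.toSignedMeasure_congr (Measure.ext_of_singleton fun x => ?_)
  rw [FiniteMeasure.toMeasure_map, FiniteMeasure.toMeasure_map,
    Measure.map_apply measurable_snd (measurableSet_singleton x),
    Measure.map_apply measurable_snd (measurableSet_singleton x), ← slice_univ, ← slice_univ, h]

theorem W2sq_add_smul_lt [CompactSpace D] {μ : FiniteMeasure D}
    (hμ : (μ : Measure D) ≪ (volume : Measure Plane).comap Subtype.val) {u v : SignedMeasure F}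
    (hu : W2sq μ u < ∞) (hv : W2sq μ v < ∞) (huv : u ≠ v) {a b : ℝ≥0} (ha : 0 < a) (hb : 0 < b)
    (hab : a + b = 1) :
    W2sq μ ((a : ℝ) • u + (b : ℝ) • v) < a * W2sq μ u + b * W2sq μ v := by
  obtain ⟨γ, hγ, hγc⟩ := exists_optimal hu
  obtain ⟨γ', hγ', hγc'⟩ := exists_optimal hv
  have hmem := add_smul_mem_couplings hγ hγ' hab
  have hcost : transportCost ((a • γ + b • γ' : FiniteMeasure (D × F)) : Measure (D × F)) =
      a * W2sq μ u + b * W2sq μ v := by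
    rw [← hγc, ← hγc', ← transportCost_smul, ← transportCost_smul, ← transportCost_add]
    rfl
  -- Equality would make the mixed plan optimal for the mixed marginal.
  refine lt_of_le_of_ne (hcost ▸ W2sq_le hmem) fun heq => huv ?_
  have hsing : ∀ x y : F, x ≠ y →
      slice (γ : Measure (D × F)) x ⟂ₘ slice (γ' : Measure (D × F)) y := fun x y hxy => by
    have h := mutuallySingular_slice_of_optimal hμ hmem
      (fun η hη => (hcost.trans heq.symm).le.trans (W2sq_le hη)) hxy
    have hs : ∀ z, slice ((a • γ + b • γ' : FiniteMeasure (D × F)) : Measure (D × F)) z =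
        a • slice (γ : Measure (D × F)) z + b • slice (γ' : Measure (D × F)) z := fun z => by
      rw [← slice_smul, ← slice_smul, ← slice_add]
      rfl
    rw [hs, hs, Measure.MutuallySingular.add_left_iff] at h
    -- Of the four singularity relations only the cross one is kept; the positive weights do not
    -- affect it.
    refine (Measure.MutuallySingular.add_right_iff.1 h.1).2.mono_ac ?_ ?_
    · exact Measure.absolutelyContinuous_smul (c := (a : ℝ≥0∞)) (by simpa using ha.ne')
    · exact Measure.absolutelyContinuous_smul (c := (b : ℝ≥0∞)) (by simpa using hb.ne')
  have hfst : (γ : Measure (D × F)).map Prod.fst = (γ' : Measure (D × F)).map Prod.fst :=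
    congrArg FiniteMeasure.toMeasure (hγ.1.trans hγ'.1.symm)
  exact eq_of_slice_eq hγ hγ' fun x => le_antisymm
    (slice_le_slice_of_mutuallySingular hfst hsing x)
    (slice_le_slice_of_mutuallySingular hfst.symm (fun y z hyz => (hsing z y hyz.symm).symm) x)

theorem strictConvexOn_W2sq [CompactSpace D] {μ : FiniteMeasure D}
    (hμ : (μ : Measure D) ≪ (volume : Measure Plane).comap Subtype.val) :
    StrictConvexOn ℝ {u : SignedMeasure F | W2sq μ u < ∞} fun u => (W2sq μ u).toReal := by
  constructor
  · intro u hu v hv a b ha hb hab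
    obtain ⟨γ, hγ, -⟩ := exists_optimal hu
    obtain ⟨γ', hγ', -⟩ := exists_optimal hv
    lift a to ℝ≥0 using ha
    lift b to ℝ≥0 using hb
    exact W2sq_lt_top_of_mem (add_smul_mem_couplings hγ hγ' (by exact_mod_cast hab))
  · intro u hu v hv huv a b ha hb hab
    lift a to ℝ≥0 using ha.le
    lift b to ℝ≥0 using hb.le
    have hlt := W2sq_add_smul_lt hμ hu hv huv (by exact_mod_cast ha) (by exact_mod_cast hb)
      (by exact_mod_cast hab)
    have hu' : a * W2sq μ u ≠ ∞ := ENNReal.mul_ne_top ENNReal.coe_ne_top (ne_of_lt hu)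
    have hv' : b * W2sq μ v ≠ ∞ := ENNReal.mul_ne_top ENNReal.coe_ne_top (ne_of_lt hv)
    have := ENNReal.toReal_strict_mono (ENNReal.add_ne_top.2 ⟨hu', hv'⟩) hlt
    rw [ENNReal.toReal_add hu' hv', ENNReal.toReal_mul, ENNReal.toReal_mul] at this
    simpa using this

/-! ### Existence and uniqueness of global solutions -/

theorem ofCoeff_singleton (ν : FiniteMeasure F) :
    ofCoeff F (fun x => (ν {x} : ℝ)) = (ν : Measure F).toSignedMeasure := by
  have hν : (ν : Measure F) = ∑ x : F, ν {x} • Measure.dirac x := by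
    conv_lhs => rw [← Measure.sum_smul_dirac (ν : Measure F), Measure.sum_fintype]
    refine Finset.sum_congr rfl fun x _ => ?_
    rw [← FiniteMeasure.ennreal_coeFn_eq_coeFn_toMeasure]
    rfl
  ext s hs
  rw [Measure.toSignedMeasure_apply_measurable hs, hν, ofCoeff, FunLike.coe_sum,
    Finset.sum_apply, measureReal_def, Measure.finsetSum_apply,
    ENNReal.toReal_sum fun x _ => measure_ne_top _ _]
  refine Finset.sum_congr rfl fun x _ => ?_
  rw [FunLike.coe_smul, Pi.smul_apply, Measure.toSignedMeasure_apply_measurable hs, Measure.smul_apply,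
    ENNReal.toReal_smul, measureReal_def]
  rfl

/-- The coordinates of a nonnegative measure are its point masses, which are weakly continuous
because indicators are continuous on the discrete space `F`. -/
theorem continuous_comp_toSignedMeasure {g : SignedMeasure F → ℝ} (hg : IsC2 F g) :
    Continuous fun ν : FiniteMeasure F => g (ν : Measure F).toSignedMeasure := by
  simp only [← ofCoeff_singleton]
  refine hg.continuous.comp (continuous_pi fun x => ?_)
  classical
  let f : C(F, ℝ) := ⟨Set.indicator {x} 1, continuous_of_discreteTopology⟩
  refine (FiniteMeasure.continuous_integral_continuousMap f).congr fun ν => ?_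
  exact (integral_indicator_one (measurableSet_singleton x)).trans
    FiniteMeasure.measureReal_eq_coe_coeFn

theorem objective_of_lt_top {g : SignedMeasure F → ℝ} {α : ℝ} {μ : FiniteMeasure D}
    {u : SignedMeasure F} (hu : W2sq μ u < ∞) :
    objective g α μ u = ((g u + α / 2 * (W2sq μ u).toReal : ℝ) : EReal) := by
  rw [objective, EReal.coe_add, EReal.coe_mul]
  congr 2
  lift W2sq μ u to ℝ≥0 using hu.ne with w
  rfl

theorem objective_of_eq_top {g : SignedMeasure F → ℝ} {α : ℝ} (hα : 0 < α) {μ : FiniteMeasure D}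
    {u : SignedMeasure F} (hu : W2sq μ u = ∞) : objective g α μ u = ⊤ := by
  rw [objective, hu, EReal.coe_ennreal_top, EReal.coe_mul_top_of_pos (by positivity),
    EReal.coe_add_top]

theorem exists_isGlobalSolution [CompactSpace D] (hF : F.Nonempty) {g : SignedMeasure F → ℝ}
    (hg : IsC2 F g) {α : ℝ} (hα : 0 < α) (μ : FiniteMeasure D) :
    ∃ u : SignedMeasure F, IsGlobalSolution g α μ u ∧ W2sq μ u < ∞ := by
  obtain ⟨x, hx⟩ := hF
  have hne : {γ : FiniteMeasure (D × F) | γ.map Prod.fst = μ}.Nonempty :=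
    ⟨μ.map fun p => (p, ⟨x, hx⟩), FiniteMeasure.toMeasure_injective (map_fst_map_prodMk _ _)⟩
  have hcont : Continuous fun γ : FiniteMeasure (D × F) =>
      g ((γ.map Prod.snd : FiniteMeasure F) : Measure F).toSignedMeasure +
        α / 2 * (transportCost (γ : Measure (D × F))).toReal := by
    refine ((continuous_comp_toSignedMeasure hg).comp
      (FiniteMeasure.continuous_map continuous_snd)).add (continuous_const.mul ?_)
    exact continuous_iff_continuousAt.2 fun γ =>
      (ENNReal.tendsto_toReal (transportCost_lt_top _).ne).comp
        continuous_transportCost.continuousAt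
  obtain ⟨γ, hγ, hmin⟩ := (isCompact_setOf_map_fst_eq μ).exists_isMinOn hne hcont.continuousOn
  have hmem : γ ∈ couplings μ ((γ.map Prod.snd : FiniteMeasure F) : Measure F).toSignedMeasure :=
    ⟨hγ, rfl⟩
  have hfin := W2sq_lt_top_of_mem hmem
  refine ⟨_, fun v => ?_, hfin⟩
  rcases eq_or_ne (W2sq μ v) ∞ with hv | hv
  · rw [objective_of_eq_top hα hv]
    exact le_top
  -- An optimal plan for the competitor `v` turns minimality over plans into minimality over
  -- marginals.
  obtain ⟨η, hη, hηc⟩ := exists_optimal hv.lt_top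
  rw [objective_of_lt_top hfin, objective_of_lt_top hv.lt_top, EReal.coe_le_coe_iff]
  have h := hmin hη.1
  have h : g ((γ.map Prod.snd : FiniteMeasure F) : Measure F).toSignedMeasure +
        α / 2 * (transportCost (γ : Measure (D × F))).toReal ≤
      g ((η.map Prod.snd : FiniteMeasure F) : Measure F).toSignedMeasure +
        α / 2 * (transportCost (η : Measure (D × F))).toReal := h
  rw [hη.2, hηc] at h
  refine le_trans ?_ h
  gcongr
  · exact (transportCost_lt_top _).ne
  · exact W2sq_le hmem

theorem IsGlobalSolution.unique [CompactSpace D] {g : SignedMeasure F → ℝ}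
    (hg : ConvexOn ℝ Set.univ g) {α : ℝ} (hα : 0 < α) {μ : FiniteMeasure D}
    (hμ : (μ : Measure D) ≪ (volume : Measure Plane).comap Subtype.val) {u v : SignedMeasure F}
    (hu : IsGlobalSolution g α μ u) (hufin : W2sq μ u < ∞) (hv : IsGlobalSolution g α μ v) :
    v = u := by
  -- Strict convexity is available only where `W2sq` is finite, so `v` must first be placed there.
  have hvfin : W2sq μ v < ∞ := by
    refine lt_top_iff_ne_top.2 fun h => ?_
    have h1 := hv u
    rw [objective_of_eq_top hα h, objective_of_lt_top hufin, top_le_iff] at h1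
    exact EReal.coe_ne_top _ h1
  have hconv : StrictConvexOn ℝ {u : SignedMeasure F | W2sq μ u < ∞}
      fun u => g u + α / 2 * (W2sq μ u).toReal := by
    have hW := strictConvexOn_W2sq (F := F) hμ
    refine (hg.subset (Set.subset_univ _) hW.1).add_strictConvexOn ?_
    refine ⟨hW.1, fun x hx y hy hxy a b ha hb hab => ?_⟩
    have := mul_lt_mul_of_pos_left (hW.2 hx hy hxy ha hb hab) (half_pos hα)
    simp only [smul_eq_mul] at this ⊢
    linarith
  refine hconv.eq_of_isMinOn ?_ ?_ hvfin hufin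
  · intro w hw
    have := hv w
    rwa [objective_of_lt_top hvfin, objective_of_lt_top hw, EReal.coe_le_coe_iff] at this
  · intro w hw
    have := hu w
    rwa [objective_of_lt_top hufin, objective_of_lt_top hw, EReal.coe_le_coe_iff] at this

end OTReg

theorem mainTheorem7
    (F : Finset OTReg.Plane) (hF : F.Nonempty)
    (D : Set OTReg.Plane)
    (hD : ∃ V : Finset OTReg.Plane, D = convexHull ℝ (V : Set OTReg.Plane))
    (hDint : (interior D).Nonempty)
    (g : SignedMeasure F → ℝ) (hg : OTReg.IsC2 F g)
    (α : ℝ) (hα : 0 < α)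
    (u_d : FiniteMeasure D)
    (ρ : D → ℝ≥0) (hρ : Continuous ρ)
    (hu_d : (u_d : Measure D) =
      ((volume : Measure OTReg.Plane).comap Subtype.val).withDensity fun x => (ρ x : ℝ≥0∞)) :
    (∃ u : SignedMeasure F,
        OTReg.IsGlobalSolution g α u_d u ∧ OTReg.objective g α u_d u < ⊤) ∧
      (ConvexOn ℝ Set.univ g →
        ∃! u : SignedMeasure F, OTReg.IsGlobalSolution g α u_d u) ∧
      StrictConvexOn ℝ {u : SignedMeasure F | OTReg.W2sq u_d u < ⊤}
        (fun u => (OTReg.W2sq u_d u).toReal) := by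
  have hDc : CompactSpace D := by
    obtain ⟨V, rfl⟩ := hD
    exact isCompact_iff_compactSpace.1 (V.finite_toSet.isCompact_convexHull ℝ)
  have hμ : (u_d : Measure D) ≪ (volume : Measure OTReg.Plane).comap Subtype.val := by
    rw [hu_d]
    exact withDensity_absolutelyContinuous _ _
  obtain ⟨u, hu, hfin⟩ := OTReg.exists_isGlobalSolution hF hg hα u_d
  refine ⟨⟨u, hu, ?_⟩, fun hconv => ⟨u, hu, fun v hv => hu.unique hconv hα hμ hfin hv⟩,
    OTReg.strictConvexOn_W2sq hμ⟩
  rw [OTReg.objective_of_lt_top hfin]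
  exact EReal.coe_lt_top _
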